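/- Let $n\in\mathbb{N}$, let $H$ be a complex separable Hilbert space whose inner product $\langle\cdot,\cdot\rangle$ is linear in the first variable, let $\{e_\alpha\}_{\alpha\in I}$ be an orthonormal basis of $H$, and let $0<s\le 1$. Let $\mathbb{T}^n=\mathbb{R}^n/\mathbb{Z}^n$ carry its Haar measure $dx$ of total mass one, and put $\widehat f(\xi)=\int_{\mathbb{T}^n}e^{-2\pi i x\cdot\xi}f(x)\,dx$ for $\xi\in\mathbb{Z}^n$. Let $\sigma:\mathbb{T}^n\times\mathbb{Z}^n\to\mathcal{L}(H)$ and let $A=T_\sigma:C^\infty(\mathbb{T}^n,H)\to C^\infty(\mathbb{T}^n,H)$ be the pseudo-differential operator with symbol $\sigma$, that is, $A$ is linear and for all $f\in C^\infty(\mathbb{T}^n,H)$ and $x\in\mathbb{T}^n$ $$Af(x)=\sum_{\xi\in\mathbb{Z}^n}e^{2\pi i x\cdot\xi}\,\sigma(x,\xi)\widehat f(\xi),$$ where the series converges unconditionally in $H$. For Banach spaces $E,F$, a bounded operator $T:E\to F$ is called $s$-nuclear if there are $g_k\in E'$, $h_k\in F$ with $\sum_k\|g_k\|^s\|h_k\|^s<\infty$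 and $Tf=\sum_k\langle g_k,f\rangle h_k$ for all $f\in E$ (an $s$-nuclear decomposition of $T$), and nuclear if it is $1$-nuclear. If $E=F$ and $T$ is nuclear, $T$ is said to have the nuclear trace $\text{n-Tr}(T)=t\in\mathbb{C}$ if $\sum_k\langle g_k,h_k\rangle=t$ for every nuclear ($1$-nuclear) decomposition of $T$. The Schatten–von Neumann class $\mathfrak{S}_s(H)$ consists of the compact operators on $H$ whose singular values, repeated according to multiplicity, have summable $s$-th powers. Let $1\le p_1,p_2<\infty$ and assume that $$\sum_{\xi\in\mathbb{Z}^n}\sum_{\alpha\in I}\|\sigma(x,\xi)e_\alpha\|^s_{L^{p_2}(\mathbb{T}^n_x,H)}<\infty .$$ Then the following hold. 1. $A$ extends to an $s$-nuclear operator $L^{p_1}(\mathbb{T}^n,H)\to L^{p_2}(\mathbb{T}^n,H)$. 2. If $p_1=p_2=p$, then every bounded extension of $A$ to $L^p(\mathbb{T}^n,H)$ is $s$-nuclear and has the nuclear trace $$\text{n-Tr}(A)=\sum_{\xi\in\mathbb{Z}^n}\sum_{\alpha\in I}\int_{\mathbb{T}^n}\langle\sigma(x,\xi)e_\alpha,e_\alpha\rangle\,dx,$$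 where the family of integrals, indexed by $(\xi,\alpha)$, is summable. 3. If $A$ is moreover a Fourier multiplier with symbol $\tau:\mathbb{Z}^n\to\mathcal{L}(H)$, that is, $\widehat{Af}(\xi)=\tau(\xi)\widehat f(\xi)$ for all $f\in C^\infty(\mathbb{T}^n,H)$ and $\xi\in\mathbb{Z}^n$, then each $\tau(\xi)$ belongs to $\mathfrak{S}_s(H)$ and has a nuclear trace; the family $(\text{n-Tr}(\tau(\xi)))_\xi$ is summable, and if $p_1=p_2=p$, the nuclear trace of every bounded extension of $A$ to $L^p(\mathbb{T}^n,H)$ is $$\text{n-Tr}(A)=\sum_{\xi\in\mathbb{Z}^n}\text{n-Tr}(\tau(\xi)).$$ -/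

import Mathlib

open MeasureTheory
open scoped ENNReal

noncomputable section

namespace PeriodicPDO

/-- The Haar (Lebesgue) measure on the torus `(ℝ/ℤ)ⁿ`, of total mass one. -/
abbrev torusMeasure (n : ℕ) : Measure (UnitAddTorus (Fin n)) :=
  Measure.pi fun _ => AddCircle.haarAddCircle

/-- The space of smooth functions `𝕋ⁿ → H`: those whose `ℤⁿ`-periodic lift to `ℝⁿ` is `C^∞`. -/
def SmoothFun (n : ℕ) (H : Type*) [NormedAddCommGroup H] [InnerProductSpace ℂ H] :
    Submodule ℂ (UnitAddTorus (Fin n) → H) where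
  carrier := {f | ContDiff ℝ ((⊤ : ℕ∞) : WithTop ℕ∞)
    fun y : Fin n → ℝ => f fun i => (y i : UnitAddCircle)}
  add_mem' {f g} hf hg := by
    simp only [Set.mem_ofPred_eq] at hf hg ⊢
    exact hf.add hg
  zero_mem' := by
    simp only [Set.mem_ofPred_eq]
    exact contDiff_const (c := (0 : H))
  smul_mem' c f hf := by
    simp only [Set.mem_ofPred_eq] at hf ⊢
    exact hf.const_smul c

/-- A smooth function on the torus is continuous. -/
theorem SmoothFun.continuous {n : ℕ} {H : Type*} [NormedAddCommGroup H] [InnerProductSpace ℂ H]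
    (f : SmoothFun n H) : Continuous (f : UnitAddTorus (Fin n) → H) := by
  have hq : IsOpenQuotientMap
      (Pi.map fun (_ : Fin n) (t : ℝ) => (t : UnitAddCircle)) :=
    IsOpenQuotientMap.piMap fun _ => QuotientAddGroup.isOpenQuotientMap_mk
  have hf : ContDiff ℝ ((⊤ : ℕ∞) : WithTop ℕ∞)
      (fun y : Fin n → ℝ => (f : UnitAddTorus (Fin n) → H) fun i => (y i : UnitAddCircle)) := f.2
  exact hq.isQuotientMap.continuous_iff.2 hf.continuous

/-- A smooth function on the torus is in every `Lᵖ`. -/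
theorem SmoothFun.memLp {n : ℕ} {H : Type*} [NormedAddCommGroup H] [InnerProductSpace ℂ H]
    (f : SmoothFun n H) (p : ℝ≥0∞) :
    MemLp (f : UnitAddTorus (Fin n) → H) p (torusMeasure n) :=
  (SmoothFun.continuous f).memLp_of_hasCompactSupport (HasCompactSupport.of_compactSpace _)

/-- The class in `Lᵖ(𝕋ⁿ, H)` of a smooth function. -/
def SmoothFun.toLp {n : ℕ} {H : Type*} [NormedAddCommGroup H] [InnerProductSpace ℂ H]
    (f : SmoothFun n H) (p : ℝ≥0∞) : Lp H p (torusMeasure n) :=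
  (SmoothFun.memLp f p).toLp f

/-- `A : C^∞(𝕋ⁿ, H) → C^∞(𝕋ⁿ, H)` is the periodic pseudo-differential operator with
operator-valued symbol `σ : 𝕋ⁿ × ℤⁿ → 𝓛(H)`:
`A f (x) = ∑_ξ e^{2πi x·ξ} σ(x, ξ) f̂(ξ)`, where `f̂(ξ) = ∫ e^{-2πi x·ξ} f(x) dx`. -/
def IsPseudoDifferential {n : ℕ} {H : Type*} [NormedAddCommGroup H] [InnerProductSpace ℂ H]
    (A : SmoothFun n H →ₗ[ℂ] SmoothFun n H)
    (σ : UnitAddTorus (Fin n) → (Fin n → ℤ) → (H →L[ℂ] H)) : Prop :=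
  ∀ (f : SmoothFun n H) (x : UnitAddTorus (Fin n)),
    HasSum (fun ξ : Fin n → ℤ =>
      UnitAddTorus.mFourier ξ x • σ x ξ (UnitAddTorus.mFourierCoeff (f : _ → H) ξ))
      ((A f : UnitAddTorus (Fin n) → H) x)

/-- `A` is the Fourier multiplier with symbol `τ : ℤⁿ → 𝓛(H)`: `(A f)^(ξ) = τ(ξ) f̂(ξ)`. -/
def IsFourierMultiplier {n : ℕ} {H : Type*} [NormedAddCommGroup H] [InnerProductSpace ℂ H]
    (A : SmoothFun n H →ₗ[ℂ] SmoothFun n H) (τ : (Fin n → ℤ) → (H →L[ℂ] H)) : Prop :=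
  ∀ (f : SmoothFun n H) (ξ : Fin n → ℤ),
    UnitAddTorus.mFourierCoeff (A f : UnitAddTorus (Fin n) → H) ξ =
      τ ξ (UnitAddTorus.mFourierCoeff (f : UnitAddTorus (Fin n) → H) ξ)

/-- The bounded operator `T : L^{p₁}(𝕋ⁿ, H) → L^{p₂}(𝕋ⁿ, H)` extends `A`. -/
def Extends {n : ℕ} {H : Type*} [NormedAddCommGroup H] [InnerProductSpace ℂ H]
    {p₁ p₂ : ℝ≥0∞} [Fact (1 ≤ p₁)] [Fact (1 ≤ p₂)]
    (T : Lp H p₁ (torusMeasure n) →L[ℂ] Lp H p₂ (torusMeasure n))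
    (A : SmoothFun n H →ₗ[ℂ] SmoothFun n H) : Prop :=
  ∀ f : SmoothFun n H, T (SmoothFun.toLp f p₁) = SmoothFun.toLp (A f) p₂

/-- `g`, `h` form an `s`-nuclear decomposition of `T`: `∑ₖ ‖gₖ‖ˢ ‖hₖ‖ˢ < ∞` and
`T f = ∑ₖ ⟨gₖ, f⟩ hₖ` for all `f`. -/
def IsNuclearDecomposition (s : ℝ) {E F : Type*} [NormedAddCommGroup E] [NormedSpace ℂ E]
    [NormedAddCommGroup F] [NormedSpace ℂ F] (T : E →L[ℂ] F)
    (g : ℕ → (E →L[ℂ] ℂ)) (h : ℕ → F) : Prop :=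
  Summable (fun k => ‖g k‖ ^ s * ‖h k‖ ^ s) ∧ ∀ f : E, HasSum (fun k => g k f • h k) (T f)

/-- `T` is an `s`-nuclear operator. -/
def IsSNuclear (s : ℝ) {E F : Type*} [NormedAddCommGroup E] [NormedSpace ℂ E]
    [NormedAddCommGroup F] [NormedSpace ℂ F] (T : E →L[ℂ] F) : Prop :=
  ∃ (g : ℕ → (E →L[ℂ] ℂ)) (h : ℕ → F), IsNuclearDecomposition s T g h

/-- `T` is nuclear and has nuclear trace `t`: `t = ∑ₖ ⟨gₖ, hₖ⟩` for every nuclear decomposition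
of `T` (an `s`-nuclear decomposition with `0 < s ≤ 1` is in particular a nuclear one). -/
def HasNuclearTrace {E : Type*} [NormedAddCommGroup E] [NormedSpace ℂ E] (T : E →L[ℂ] E)
    (t : ℂ) : Prop :=
  IsSNuclear 1 T ∧
    ∀ (g : ℕ → (E →L[ℂ] ℂ)) (h : ℕ → E), IsNuclearDecomposition 1 T g h →
      HasSum (fun k => g k (h k)) t

/-- `T` is in the Schatten-von Neumann class of order `s`: `T` is compact and the `s`-th powers of
its nonzero singular values have a finite sum. The number `r > 0` is a singular value of `T` with
multiplicity the dimension of the eigenspace of `T* T` for the eigenvalue `r ^ 2`. -/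
def IsSchatten (s : ℝ) {H : Type*} [NormedAddCommGroup H] [InnerProductSpace ℂ H]
    [CompleteSpace H] (T : H →L[ℂ] H) : Prop :=
  IsCompactOperator T ∧
    ∑' r : Set.Ioi (0 : ℝ),
      (Module.finrank ℂ (Module.End.eigenspace
        ((ContinuousLinearMap.adjoint T ∘L T : H →L[ℂ] H) : Module.End ℂ H)
        (((r : ℝ) ^ 2 : ℝ) : ℂ)) : ℝ≥0∞) * ENNReal.ofReal ((r : ℝ) ^ s) < ⊤

end PeriodicPDO

end

/-! Applied to a smooth `f`, with `f̂(ξ)` expanded in the basis, the operator becomes a series of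
rank one operators indexed by `q = (ξ, α)`: the functional `f ↦ ⟨f̂(ξ), e_α⟩` times the function
`e^{2πi x·ξ} σ(x, ξ) e_α`. This function is the image under `A` of a monomial, hence smooth. The
functionals have norm at most one because the torus has mass one, and characters are unimodular, so
the hypothesis on `σ` is exactly `s`-summability. The series converges in `L^{p₂}` and also
pointwise almost everywhere, which identifies it with `A f` (`eq_toLp_of_hasSum`); density of
monomials makes the extension unique (`clm_ext_monomial`).

The trace does not depend on the decomposition because `Lᵖ(𝕋ⁿ, H)` has the metric approximation
property (`hasMetricApproximation_Lp`): average over a finite partition and project the values to a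
finite dimensional subspace.

For a multiplier, the `ξ`-th Fourier coefficient of the function with index `(ξ, α)` is `τ(ξ) e_α`,
so `∑_α ‖τ(ξ) e_α‖ ^ s` is finite. Concavity of `t ^ (s / 2)` turns this into a bound on singular
values (`sum_rpow_singularValues_le`). -/

noncomputable section

namespace PeriodicPDO

/-! ### Nuclear representations and the trace in Banach spaces -/

section Abstract

variable {E F : Type*} [NormedAddCommGroup E] [NormedSpace ℂ E]
  [NormedAddCommGroup F] [NormedSpace ℂ F]

/-- The finite rank operators, as the span of the operators of rank one. -/
def finiteRank (E F : Type*) [NormedAddCommGroup E] [NormedSpace ℂ E]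
    [NormedAddCommGroup F] [NormedSpace ℂ F] : Submodule ℂ (E →L[ℂ] F) :=
  Submodule.span ℂ (Set.range fun q : (E →L[ℂ] ℂ) × F => q.1.smulRight q.2)

theorem smulRight_mem_finiteRank (φ : E →L[ℂ] ℂ) (v : F) : φ.smulRight v ∈ finiteRank E F :=
  Submodule.subset_span ⟨(φ, v), rfl⟩

theorem comp_mem_finiteRank {E' F' : Type*} [NormedAddCommGroup E'] [NormedSpace ℂ E']
    [NormedAddCommGroup F'] [NormedSpace ℂ F'] {S : E →L[ℂ] F} (hS : S ∈ finiteRank E F)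
    (L : F →L[ℂ] F') (R : E' →L[ℂ] E) : L ∘L S ∘L R ∈ finiteRank E' F' := by
  induction hS using Submodule.span_induction with
  | mem x hx =>
    obtain ⟨⟨φ, v⟩, rfl⟩ := hx
    have : L ∘L (φ.smulRight v) ∘L R = (φ ∘L R).smulRight (L v) := by
      ext; simp
    simpa only [this] using smulRight_mem_finiteRank _ _
  | zero => simp
  | add x y _ _ hx hy =>
    rw [ContinuousLinearMap.add_comp, ContinuousLinearMap.comp_add]
    exact add_mem hx hy
  | smul c x _ hx =>
    rw [ContinuousLinearMap.smul_comp, ContinuousLinearMap.comp_smul]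
    exact Submodule.smul_mem _ _ hx

theorem isCompactOperator_of_mem_finiteRank {S : E →L[ℂ] F} (hS : S ∈ finiteRank E F) :
    IsCompactOperator S := by
  induction hS using Submodule.span_induction with
  | mem x hx =>
    obtain ⟨⟨φ, v⟩, rfl⟩ := hx
    exact (isCompactOperator_of_locallyCompactSpace_dom φ).clm_comp
      (ContinuousLinearMap.toSpanSingleton ℂ v)
  | zero => exact isCompactOperator_zero
  | add x y _ _ hx hy => exact hx.add hy
  | smul c x _ hx => exact hx.smul c

/-- The metric approximation property, tested on finite sets. -/
def HasMetricApproximation (E : Type*) [NormedAddCommGroup E] [NormedSpace ℂ E] : Prop :=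
  ∀ (K : Finset E) (ε : ℝ), 0 < ε →
    ∃ S ∈ finiteRank E E, ‖S‖ ≤ 1 ∧ ∀ v ∈ K, ‖v - S v‖ ≤ ε

theorem norm_apply_le_of_norm_le_one {S : E →L[ℂ] F} (hS : ‖S‖ ≤ 1) (v : E) : ‖S v‖ ≤ ‖v‖ :=
  (S.le_of_opNorm_le hS v).trans_eq (one_mul _)

/-- For `S = φ ⊗ v` the sum is `φ (∑ g k v • h k) = φ 0`, and the claim is linear in `S`. -/
theorem hasSum_trace_finiteRank {ι : Type*} {g : ι → E →L[ℂ] ℂ} {h : ι → E}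
    (h0 : ∀ f, HasSum (fun k => g k f • h k) 0) {S : E →L[ℂ] E} (hS : S ∈ finiteRank E E) :
    HasSum (fun k => g k (S (h k))) 0 := by
  induction hS using Submodule.span_induction with
  | mem x hx =>
    obtain ⟨⟨φ, v⟩, rfl⟩ := hx
    simpa [mul_comm] using (h0 v).mapL φ
  | zero => simp
  | add x y _ _ hx hy => simpa using hx.add hy
  | smul c x _ hx => simpa using hx.mul_left c

/-- In a space with the approximation property the trace of a nuclear representation of the zero
operator vanishes. -/
theorem HasMetricApproximation.hasSum_trace_zero (hE : HasMetricApproximation E) {ι : Type*}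
    {g : ι → E →L[ℂ] ℂ} {h : ι → E} (hs : Summable fun k => ‖g k‖ * ‖h k‖)
    (h0 : ∀ f, HasSum (fun k => g k f • h k) 0) : HasSum (fun k => g k (h k)) 0 := by
  classical
  have hsum : Summable fun k => g k (h k) :=
    Summable.of_norm_bounded hs fun k => (g k).le_opNorm _
  suffices ∑' k, g k (h k) = 0 by simpa [this] using hsum.hasSum
  rw [← norm_le_zero_iff]
  refine le_of_forall_pos_le_add fun ε hε => ?_
  -- The tail is later counted twice, since `‖h k - S (h k)‖ ≤ 2 * ‖h k‖`; hence `ε / 4`.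
  obtain ⟨K, hK⟩ := (summable_iff_vanishing_norm.1 hs) (ε / 4) (by positivity)
  have htail : ∑' k : {k // k ∉ K}, ‖g k‖ * ‖h k‖ ≤ ε / 4 := by
    refine Real.tsum_le_of_sum_le (fun k => by positivity) fun t => ?_
    have := hK (t.map (Function.Embedding.subtype _)) (by
      rw [Finset.disjoint_left]
      simp +contextual)
    rw [Finset.sum_map] at this
    exact (le_abs_self _).trans this.le
  set M := ∑ k ∈ K, ‖g k‖ with hM
  have hM0 : 0 ≤ M := Finset.sum_nonneg fun _ _ => norm_nonneg _
  -- `M + 1` in place of `M` avoids division by zero; the terms in `K` then contribute at most `ε /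
  -- 2`.
  obtain ⟨S, hS, hS1, hSK⟩ := hE (K.image h) (ε / (2 * (M + 1))) (by positivity)
  -- The composite with `S` has trace zero, so it can be subtracted without changing the sum.
  have hdiff : HasSum (fun k => g k (h k - S (h k))) (∑' k, g k (h k)) := by
    simpa using hsum.hasSum.sub (hasSum_trace_finiteRank h0 hS)
  have hb : ∀ k, ‖g k (h k - S (h k))‖ ≤ ‖g k‖ * ‖h k - S (h k)‖ := fun k => (g k).le_opNorm _
  have hb2 : ∀ k, ‖g k‖ * ‖h k - S (h k)‖ ≤ 2 * (‖g k‖ * ‖h k‖) := fun k => by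
    have := norm_sub_le (h k) (S (h k))
    have := norm_apply_le_of_norm_le_one hS1 (h k)
    nlinarith [norm_nonneg (g k)]
  have hs' : Summable fun k => ‖g k‖ * ‖h k - S (h k)‖ :=
    Summable.of_nonneg_of_le (fun k => by positivity) hb2 (hs.mul_left 2)
  have h1 : ‖∑' k, g k (h k)‖ ≤ ∑' k, ‖g k‖ * ‖h k - S (h k)‖ := by
    rw [← hdiff.tsum_eq]
    exact tsum_of_norm_bounded hs'.hasSum hb
  rw [← hs'.sum_add_tsum_subtype_compl K] at h1
  have h2 : ∑ k ∈ K, ‖g k‖ * ‖h k - S (h k)‖ ≤ ε / 2 := by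
    calc _ ≤ ∑ k ∈ K, ‖g k‖ * (ε / (2 * (M + 1))) := Finset.sum_le_sum fun k hk =>
          mul_le_mul_of_nonneg_left (hSK _ (Finset.mem_image_of_mem _ hk)) (norm_nonneg _)
      _ = M * (ε / (2 * (M + 1))) := by rw [← Finset.sum_mul]
      _ ≤ (M + 1) * (ε / (2 * (M + 1))) := by gcongr; linarith
      _ = ε / 2 := by field_simp
  have h3 : ∑' k : {k // k ∉ K}, ‖g k‖ * ‖h k - S (h k)‖ ≤ 2 * (ε / 4) := by
    refine le_trans ?_ (mul_le_mul_of_nonneg_left htail zero_le_two)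
    rw [← tsum_mul_left]
    exact Summable.tsum_le_tsum (fun k => hb2 k) (hs'.subtype _) ((hs.mul_left 2).subtype _)
  linarith

variable {ι : Type*}

theorem isNuclearDecomposition_extend {s : ℝ} (hs : 0 < s) {T : E →L[ℂ] F} {g : ι → E →L[ℂ] ℂ}
    {h : ι → F} (hgh : Summable fun k => ‖g k‖ ^ s * ‖h k‖ ^ s)
    (hT : ∀ f, HasSum (fun k => g k f • h k) (T f)) {i : ι → ℕ} (hi : i.Injective) :
    IsNuclearDecomposition s T (Function.extend i g 0) (Function.extend i h 0) := by
  have hz : ∀ x ∉ Set.range i, Function.extend i g 0 x = 0 ∧ Function.extend i h 0 x = 0 :=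
    fun x hx => ⟨Function.extend_apply' _ _ _ hx, Function.extend_apply' _ _ _ hx⟩
  constructor
  · refine (hi.summable_iff ?_).1 ?_
    · intro x hx
      simp [hz x hx, Real.zero_rpow hs.ne']
    · simpa [Function.comp_def, hi.extend_apply] using hgh
  · intro f
    refine (hi.hasSum_iff ?_).1 ?_
    · intro x hx
      simp [hz x hx]
    · simpa [Function.comp_def, hi.extend_apply] using hT f

theorem IsSNuclear.of_countable [Countable ι] {s : ℝ} (hs : 0 < s) {T : E →L[ℂ] F}
    {g : ι → E →L[ℂ] ℂ} {h : ι → F} (hgh : Summable fun k => ‖g k‖ ^ s * ‖h k‖ ^ s)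
    (hT : ∀ f, HasSum (fun k => g k f • h k) (T f)) : IsSNuclear s T :=
  let ⟨_, hi⟩ := exists_injective_nat ι
  ⟨_, _, isNuclearDecomposition_extend hs hgh hT hi⟩

/-- Two decompositions of `T`, one with its sign reversed, combine over `ι ⊕ ℕ` into a nuclear
representation of zero, whose trace vanishes. -/
theorem HasMetricApproximation.hasNuclearTrace (hE : HasMetricApproximation E) [Countable ι]
    {T : E →L[ℂ] E} {g : ι → E →L[ℂ] ℂ} {h : ι → E} (hgh : Summable fun k => ‖g k‖ * ‖h k‖)
    (hT : ∀ f, HasSum (fun k => g k f • h k) (T f)) {t : ℂ}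
    (ht : HasSum (fun k => g k (h k)) t) : HasNuclearTrace T t := by
  refine ⟨IsSNuclear.of_countable one_pos (by simpa using hgh) hT, fun g' h' hd => ?_⟩
  have hgh' : Summable fun k => ‖g' k‖ * ‖h' k‖ := by simpa using hd.1
  have hsum : Summable fun k => g' k (h' k) :=
    Summable.of_norm_bounded hgh' fun k => (g' k).le_opNorm _
  set G : ι ⊕ ℕ → E →L[ℂ] ℂ := Sum.elim g g'
  set K : ι ⊕ ℕ → E := Sum.elim h fun j => -h' j
  have key : HasSum (fun k => G k (K k)) 0 := by
    refine hE.hasSum_trace_zero ?_ fun f => ?_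
    · refine (HasSum.sum (f := fun k => ‖G k‖ * ‖K k‖) hgh.hasSum
        (b := ∑' k, ‖g' k‖ * ‖h' k‖) ?_).summable
      simpa [Function.comp_def, G, K] using hgh'.hasSum
    · rw [← add_neg_cancel (T f)]
      refine HasSum.sum (hT f) ?_
      simpa [Function.comp_def, G, K] using (hd.2 f).neg
  have key' : HasSum (fun k => G k (K k)) (t + -∑' k, g' k (h' k)) := by
    refine HasSum.sum ht ?_
    simpa [Function.comp_def, G, K] using hsum.hasSum.neg
  have := key.unique key'
  rw [show t = ∑' k, g' k (h' k) by linear_combination -this]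
  exact hsum.hasSum

/-- All but finitely many terms are at most one, and there `a ≤ a ^ s`. -/
theorem summable_of_summable_rpow {s : ℝ} (hs0 : 0 < s) (hs1 : s ≤ 1) {a : ι → ℝ}
    (ha : ∀ k, 0 ≤ a k) (h : Summable fun k => a k ^ s) : Summable a := by
  have h1 := h.tendsto_cofinite_zero.eventually (ge_mem_nhds (zero_lt_one' ℝ))
  refine Summable.of_norm_bounded_eventually h ?_
  filter_upwards [h1] with k hk
  have h2 : a k ≤ 1 := by
    by_contra! hc
    exact absurd hk (not_le.2 (Real.one_lt_rpow hc hs0))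
  rw [Real.norm_of_nonneg (ha k)]
  exact Real.self_le_rpow_of_le_one (ha k) h2 hs1

/-- The rank one series converges absolutely in operator norm, so `T` is a norm limit of finite rank
operators. -/
theorem isCompactOperator_of_hasSum [CompleteSpace F] {T : E →L[ℂ] F} {g : ι → E →L[ℂ] ℂ}
    {h : ι → F} (hgh : Summable fun k => ‖g k‖ * ‖h k‖)
    (hT : ∀ f, HasSum (fun k => g k f • h k) (T f)) : IsCompactOperator T := by
  have hs : Summable fun k => (g k).smulRight (h k) :=
    Summable.of_norm (by simpa using hgh)
  have hTe : HasSum (fun k => (g k).smulRight (h k)) T := by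
    convert hs.hasSum using 1
    ext f
    refine (hT f).unique ?_
    simpa using hs.hasSum.mapL (ContinuousLinearMap.apply ℂ F f)
  refine isCompactOperator_of_tendsto hTe (Filter.Eventually.of_forall fun K => ?_)
  exact isCompactOperator_of_mem_finiteRank
    (Submodule.sum_mem _ fun k _ => smulRight_mem_finiteRank _ _)

end Abstract

/-! ### Metric approximation in Hilbert spaces -/

section Hilbert

variable {H : Type*} [NormedAddCommGroup H] [InnerProductSpace ℂ H]

theorem starProjection_mem_finiteRank (V : Submodule ℂ H) [FiniteDimensional ℂ V] :
    V.starProjection ∈ finiteRank H H := by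
  rw [(stdOrthonormalBasis ℂ V).starProjection_eq_sum_rankOne]
  exact Submodule.sum_mem _ fun i _ => smulRight_mem_finiteRank (innerSL ℂ _) _

theorem hasMetricApproximation_hilbert : HasMetricApproximation H := by
  intro K ε hε
  refine ⟨(Submodule.span ℂ (K : Set H)).starProjection, starProjection_mem_finiteRank _,
    Submodule.starProjection_norm_le _, fun v hv => ?_⟩
  rw [Submodule.starProjection_eq_self_iff.2 (Submodule.subset_span hv), sub_self, norm_zero]
  exact hε.le

end Hilbert

/-! ### Metric approximation in vector-valued `Lᵖ` over a probability space -/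

section LpApproximation

variable {X : Type*} [MeasurableSpace X] {μ : Measure X}
  {H : Type*} [NormedAddCommGroup H] [InnerProductSpace ℂ H] {p : ℝ≥0∞}

theorem norm_integral_smul_le [IsProbabilityMeasure μ] (hp : 1 ≤ p) {w : X → ℂ}
    (hw : ∀ x, ‖w x‖ ≤ 1) {f : X → H} (hf : MemLp f p μ) :
    ‖∫ x, w x • f x ∂μ‖ ≤ (eLpNorm f p μ).toReal := by
  have hi := hf.integrable hp
  calc ‖∫ x, w x • f x ∂μ‖ ≤ ∫ x, ‖f x‖ ∂μ := by
        refine norm_integral_le_of_norm_le hi.norm (Filter.Eventually.of_forall fun x => ?_)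
        rw [norm_smul]
        exact mul_le_of_le_one_left (norm_nonneg _) (hw x)
    _ = (eLpNorm f 1 μ).toReal := by
        rw [eLpNorm_one_eq_lintegral_enorm, integral_norm_eq_lintegral_enorm hf.1]
    _ ≤ (eLpNorm f p μ).toReal := ENNReal.toReal_mono hf.eLpNorm_ne_top
        (eLpNorm_le_eLpNorm_of_exponent_le hp hf.1)

theorem integrable_smul_of_memLp [IsProbabilityMeasure μ] (hp : 1 ≤ p) {w : X → ℂ}
    (hwm : AEStronglyMeasurable w μ) (hw : ∀ x, ‖w x‖ ≤ 1) {f : X → H} (hf : MemLp f p μ) :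
    Integrable (fun x => w x • f x) μ := by
  refine (hf.integrable hp).mono (hwm.smul hf.1) (Filter.Eventually.of_forall fun x => ?_)
  rw [norm_smul]
  exact mul_le_of_le_one_left (norm_nonneg _) (hw x)

/-- Integration against a scalar weight bounded by one, as an operator `Lᵖ(μ, H) → H`. -/
def weightedIntegral [IsProbabilityMeasure μ] [hp : Fact (1 ≤ p)] (w : X → ℂ)
    (hwm : AEStronglyMeasurable w μ) (hw : ∀ x, ‖w x‖ ≤ 1) : Lp H p μ →L[ℂ] H :=
  LinearMap.mkContinuous
    { toFun := fun f => ∫ x, w x • f x ∂μ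
      map_add' := fun f g => by
        rw [← integral_add (integrable_smul_of_memLp hp.out hwm hw (Lp.memLp f))
          (integrable_smul_of_memLp hp.out hwm hw (Lp.memLp g))]
        refine integral_congr_ae ?_
        filter_upwards [Lp.coeFn_add f g] with x hx
        rw [hx, Pi.add_apply, smul_add]
      map_smul' := fun c f => by
        rw [RingHom.id_apply, ← integral_smul]
        refine integral_congr_ae ?_
        filter_upwards [Lp.coeFn_smul c f] with x hx
        rw [hx, Pi.smul_apply, smul_comm] }
    1 fun f => by
      rw [one_mul]
      exact norm_integral_smul_le hp.out hw (Lp.memLp f)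

theorem weightedIntegral_apply [IsProbabilityMeasure μ] [Fact (1 ≤ p)] {w : X → ℂ}
    (hwm : AEStronglyMeasurable w μ) (hw : ∀ x, ‖w x‖ ≤ 1) (f : Lp H p μ) :
    weightedIntegral w hwm hw f = ∫ x, w x • f x ∂μ := rfl

theorem norm_weightedIntegral_le [IsProbabilityMeasure μ] [Fact (1 ≤ p)] {w : X → ℂ}
    (hwm : AEStronglyMeasurable w μ) (hw : ∀ x, ‖w x‖ ≤ 1) :
    ‖(weightedIntegral w hwm hw : Lp H p μ →L[ℂ] H)‖ ≤ 1 :=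
  LinearMap.mkContinuous_norm_le _ zero_le_one _

/-- The map sending `v` to the function which is `v` on `s` and zero elsewhere. -/
def indicatorConstCLM [IsFiniteMeasure μ] [Fact (1 ≤ p)] {s : Set X} (hs : MeasurableSet s) :
    H →L[ℂ] Lp H p μ :=
  LinearMap.mkContinuous
    { toFun := fun v => indicatorConstLp p hs (measure_ne_top μ s) v
      map_add' := fun v w => indicatorConstLp_add.symm
      map_smul' := fun c v => by
        rw [RingHom.id_apply]
        ext1
        filter_upwards [Lp.coeFn_smul c (indicatorConstLp p hs (measure_ne_top μ s) v),
          indicatorConstLp_coeFn (p := p) (hs := hs) (hμs := measure_ne_top μ s) (c := v),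
          indicatorConstLp_coeFn (p := p) (hs := hs) (hμs := measure_ne_top μ s) (c := c • v)]
          with x h1 h2 h3
        rw [h1, h3, Pi.smul_apply, h2, Set.indicator_const_smul_apply] }
    (μ.real s ^ (1 / p.toReal)) fun v => by
      rw [mul_comm]
      exact norm_indicatorConstLp_le (hs := hs) (hμs := measure_ne_top μ s)

theorem indicatorConstCLM_coeFn [IsFiniteMeasure μ] [Fact (1 ≤ p)] {s : Set X}
    (hs : MeasurableSet s) (v : H) :
    (indicatorConstCLM hs v : Lp H p μ) =ᵐ[μ] s.indicator fun _ => v :=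
  indicatorConstLp_coeFn (hs := hs) (hμs := measure_ne_top μ s)

variable {J : Type*} [Fintype J] {φ : X → J}

theorem lintegral_eq_sum_fibers (hφ : ∀ j, MeasurableSet (φ ⁻¹' {j})) (F : X → ℝ≥0∞) :
    ∫⁻ x, F x ∂μ = ∑ j, ∫⁻ x in φ ⁻¹' {j}, F x ∂μ := by
  have hU : (⋃ j, φ ⁻¹' {j}) = Set.univ := by
    ext x; simp
  rw [← setLIntegral_univ, ← hU, lintegral_iUnion hφ, tsum_fintype]
  intro i j hij
  exact Disjoint.preimage _ (Set.disjoint_singleton.2 hij)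

/-- Hölder on `s` bounds the `L¹` norm by `N * μ s ^ (1 - 1 / p)`; the powers of `μ s` cancel
against the average. -/
theorem enorm_rpow_mul_le_of_le_average {E : Type*} [NormedAddCommGroup E] [IsFiniteMeasure μ]
    (hp : 1 ≤ p) (hpt : p ≠ ⊤) {s : Set X} {f : X → E} (hf : AEStronglyMeasurable f μ) {c : E}
    (hc : ‖c‖ₑ ≤ (μ s)⁻¹ * ∫⁻ x in s, ‖f x‖ₑ ∂μ) :
    ‖c‖ₑ ^ p.toReal * μ s ≤ ∫⁻ x in s, ‖f x‖ₑ ^ p.toReal ∂μ := by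
  have hp0 : p ≠ 0 := (zero_lt_one.trans_le hp).ne'
  have hq : 0 < p.toReal := ENNReal.toReal_pos hp0 hpt
  rcases eq_or_ne (μ s) 0 with h0 | h0
  · simp [h0]
  have ht : μ s ≠ ⊤ := measure_ne_top _ _
  set N := eLpNorm f p (μ.restrict s)
  have hN : N ^ p.toReal = ∫⁻ x in s, ‖f x‖ₑ ^ p.toReal ∂μ := by
    simp only [N]
    rw [eLpNorm_eq_lintegral_rpow_enorm_toReal hp0 hpt, ← ENNReal.rpow_mul,
      one_div_mul_cancel hq.ne', ENNReal.rpow_one]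
  have h1 : ∫⁻ x in s, ‖f x‖ₑ ∂μ ≤ N * μ s ^ (1 - 1 / p.toReal) := by
    have := eLpNorm_le_eLpNorm_mul_rpow_measure_univ (μ := μ.restrict s) hp hf.restrict
    simpa [eLpNorm_one_eq_lintegral_enorm] using this
  have h2 : ‖c‖ₑ * μ s ^ (1 / p.toReal) ≤ N := by
    calc ‖c‖ₑ * μ s ^ (1 / p.toReal)
        ≤ (μ s)⁻¹ * (N * μ s ^ (1 - 1 / p.toReal)) * μ s ^ (1 / p.toReal) := by
          gcongr
          exact hc.trans (by gcongr)
      _ = N * ((μ s)⁻¹ * (μ s ^ (1 - 1 / p.toReal) * μ s ^ (1 / p.toReal))) := by ring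
      _ = N := by
          rw [← ENNReal.rpow_add _ _ h0 ht, sub_add_cancel, ENNReal.rpow_one,
            ENNReal.inv_mul_cancel h0 ht, mul_one]
  calc ‖c‖ₑ ^ p.toReal * μ s = (‖c‖ₑ * μ s ^ (1 / p.toReal)) ^ p.toReal := by
        rw [ENNReal.mul_rpow_of_nonneg _ _ hq.le, ← ENNReal.rpow_mul, one_div_mul_cancel hq.ne',
          ENNReal.rpow_one]
    _ ≤ N ^ p.toReal := by gcongr
    _ = _ := hN

/-- Averaging over the fibers of a finite partition is a contraction in `Lᵖ`. -/
theorem eLpNorm_le_of_le_average {E : Type*} [NormedAddCommGroup E] [IsFiniteMeasure μ]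
    (hp : 1 ≤ p) (hpt : p ≠ ⊤) (hφ : ∀ j, MeasurableSet (φ ⁻¹' {j})) {f : X → E}
    (hf : AEStronglyMeasurable f μ) {c : J → E}
    (hc : ∀ j, ‖c j‖ₑ ≤ (μ (φ ⁻¹' {j}))⁻¹ * ∫⁻ x in φ ⁻¹' {j}, ‖f x‖ₑ ∂μ) :
    eLpNorm (fun x => c (φ x)) p μ ≤ eLpNorm f p μ := by
  have hp0 : p ≠ 0 := (zero_lt_one.trans_le hp).ne'
  rw [eLpNorm_eq_lintegral_rpow_enorm_toReal hp0 hpt, eLpNorm_eq_lintegral_rpow_enorm_toReal hp0 hpt]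
  refine ENNReal.rpow_le_rpow ?_ (by positivity)
  rw [lintegral_eq_sum_fibers hφ, lintegral_eq_sum_fibers hφ]
  refine Finset.sum_le_sum fun j _ => ?_
  calc ∫⁻ x in φ ⁻¹' {j}, ‖c (φ x)‖ₑ ^ p.toReal ∂μ
      = ∫⁻ _ in φ ⁻¹' {j}, ‖c j‖ₑ ^ p.toReal ∂μ := by
        refine setLIntegral_congr_fun (hφ j) fun x hx => ?_
        rw [show φ x = j from hx]
    _ = ‖c j‖ₑ ^ p.toReal * μ (φ ⁻¹' {j}) := setLIntegral_const _ _
    _ ≤ _ := enorm_rpow_mul_le_of_le_average hp hpt hf (hc j)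

/-- The operator `Lᵖ(μ, H) → H` of integration over a measurable set. -/
def setIntegralCLM [IsProbabilityMeasure μ] [Fact (1 ≤ p)] {s : Set X} (hs : MeasurableSet s) :
    Lp H p μ →L[ℂ] H :=
  weightedIntegral (s.indicator 1) (aestronglyMeasurable_one.indicator hs) fun x => by
    by_cases hx : x ∈ s <;> simp [hx]

theorem setIntegralCLM_apply [IsProbabilityMeasure μ] [Fact (1 ≤ p)] {s : Set X}
    (hs : MeasurableSet s) (f : Lp H p μ) : setIntegralCLM hs f = ∫ x in s, f x ∂μ := by
  rw [setIntegralCLM, weightedIntegral_apply, ← integral_indicator hs]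
  congr with x
  by_cases hx : x ∈ s <;> simp [hx]

/-- Averaging over the fibers of `φ`, followed by the projection to `V` pointwise. -/
def averageProj [IsProbabilityMeasure μ] [Fact (1 ≤ p)] (hφ : ∀ j, MeasurableSet (φ ⁻¹' {j}))
    (V : Submodule ℂ H) [V.HasOrthogonalProjection] : Lp H p μ →L[ℂ] Lp H p μ :=
  ∑ j, ((μ.real (φ ⁻¹' {j}))⁻¹ : ℂ) •
    (indicatorConstCLM (hφ j) ∘L V.starProjection ∘L setIntegralCLM (hφ j))

theorem averageProj_coeFn [IsProbabilityMeasure μ] [Fact (1 ≤ p)]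
    (hφ : ∀ j, MeasurableSet (φ ⁻¹' {j})) (V : Submodule ℂ H) [V.HasOrthogonalProjection]
    (f : Lp H p μ) : averageProj hφ V f =ᵐ[μ] fun x => ((μ.real (φ ⁻¹' {φ x}))⁻¹ : ℂ) •
      V.starProjection (∫ y in φ ⁻¹' {φ x}, f y ∂μ) := by
  classical
  have h1 : averageProj hφ V f = ∑ j, indicatorConstCLM (hφ j) (((μ.real (φ ⁻¹' {j}))⁻¹ : ℂ) •
      V.starProjection (∫ y in φ ⁻¹' {j}, f y ∂μ)) := by
    simp [averageProj, setIntegralCLM_apply]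
  have h2 : ∀ᵐ x ∂μ, ∀ j, (indicatorConstCLM (hφ j) (((μ.real (φ ⁻¹' {j}))⁻¹ : ℂ) •
      V.starProjection (∫ y in φ ⁻¹' {j}, f y ∂μ)) : Lp H p μ) x =
      (φ ⁻¹' {j}).indicator (fun _ => ((μ.real (φ ⁻¹' {j}))⁻¹ : ℂ) •
      V.starProjection (∫ y in φ ⁻¹' {j}, f y ∂μ)) x :=
    ae_all_iff.2 fun j => indicatorConstCLM_coeFn _ _
  rw [h1]
  filter_upwards [h2, Lp.coeFn_finsetSum (p := p) (μ := μ) Finset.univ fun j =>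
    indicatorConstCLM (hφ j) (((μ.real (φ ⁻¹' {j}))⁻¹ : ℂ) •
      V.starProjection (∫ y in φ ⁻¹' {j}, f y ∂μ))] with x hx hx'
  rw [hx', Finset.sum_apply, Finset.sum_congr rfl fun j _ => hx j,
    Finset.sum_eq_single (φ x)]
  · simp
  · intro j _ hj
    simp [Set.indicator, hj.symm]
  · simp

theorem averageProj_mem_finiteRank [IsProbabilityMeasure μ] [Fact (1 ≤ p)]
    (hφ : ∀ j, MeasurableSet (φ ⁻¹' {j})) (V : Submodule ℂ H) [FiniteDimensional ℂ V] :
    (averageProj hφ V : Lp H p μ →L[ℂ] Lp H p μ) ∈ finiteRank _ _ :=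
  Submodule.sum_mem _ fun _ _ => Submodule.smul_mem _ _
    (comp_mem_finiteRank (starProjection_mem_finiteRank V) _ _)

theorem norm_averageProj_le [IsProbabilityMeasure μ] [hp : Fact (1 ≤ p)] (hpt : p ≠ ⊤)
    (hφ : ∀ j, MeasurableSet (φ ⁻¹' {j})) (V : Submodule ℂ H) [V.HasOrthogonalProjection] :
    ‖(averageProj hφ V : Lp H p μ →L[ℂ] Lp H p μ)‖ ≤ 1 := by
  refine ContinuousLinearMap.opNorm_le_bound _ zero_le_one fun f => ?_
  rw [one_mul, Lp.norm_def, Lp.norm_def, eLpNorm_congr_ae (averageProj_coeFn hφ V f)]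
  refine ENNReal.toReal_mono (Lp.eLpNorm_ne_top f) ?_
  refine eLpNorm_le_of_le_average (φ := φ) (c := fun j => ((μ.real (φ ⁻¹' {j}))⁻¹ : ℂ) •
    V.starProjection (∫ y in φ ⁻¹' {j}, f y ∂μ)) hp.out hpt hφ (Lp.aestronglyMeasurable f)
    fun j => ?_
  -- On a null fiber the normalizing factor is `0⁻¹ = 0`, so the value there is zero.
  rcases eq_or_ne (μ (φ ⁻¹' {j})) 0 with h0 | h0
  · simp [measureReal_def, h0]
  rw [enorm_smul]
  gcongr
  · rw [← ofReal_norm, norm_inv, Complex.norm_real, Real.norm_of_nonneg measureReal_nonneg,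
      measureReal_def, ENNReal.ofReal_inv_of_pos (ENNReal.toReal_pos h0 (measure_ne_top _ _)),
      ENNReal.ofReal_toReal (measure_ne_top _ _)]
  · refine le_trans ?_ (enorm_integral_le_lintegral_enorm _)
    rw [enorm_le_iff_norm_le]
    exact norm_apply_le_of_norm_le_one V.starProjection_norm_le _

theorem averageProj_of_ae_eq [IsProbabilityMeasure μ] [CompleteSpace H] [Fact (1 ≤ p)]
    (hφ : ∀ j, MeasurableSet (φ ⁻¹' {j})) (V : Submodule ℂ H) [V.HasOrthogonalProjection]
    {f : Lp H p μ} {c : J → H} (hc : ∀ j, c j ∈ V) (hf : f =ᵐ[μ] fun x => c (φ x)) :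
    averageProj hφ V f = f := by
  -- The normalizing factor is usable only off null fibers; finitely many of them have null union.
  have hpos : ∀ᵐ x ∂μ, μ (φ ⁻¹' {φ x}) ≠ 0 := by
    rw [ae_iff]
    have : {x | ¬ μ (φ ⁻¹' {φ x}) ≠ 0} ⊆ ⋃ j : {j // μ (φ ⁻¹' {j}) = 0}, φ ⁻¹' {j.1} := by
      intro x hx
      simp only [ne_eq, not_not, Set.mem_ofPred_eq] at hx
      exact Set.mem_iUnion.2 ⟨⟨φ x, hx⟩, rfl⟩
    exact measure_mono_null this (measure_iUnion_null fun j => j.2)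
  ext1
  filter_upwards [averageProj_coeFn hφ V f, hf, hpos] with x h1 h2 h3
  have h4 : ∫ y in φ ⁻¹' {φ x}, f y ∂μ = μ.real (φ ⁻¹' {φ x}) • c (φ x) := by
    rw [← setIntegral_const]
    refine setIntegral_congr_ae (hφ _) ?_
    filter_upwards [hf] with y hy hy'
    rw [hy, show φ y = φ x from hy']
  have h5 : (μ.real (φ ⁻¹' {φ x}) : ℂ) ≠ 0 := by
    exact_mod_cast (ENNReal.toReal_pos h3 (measure_ne_top _ _)).ne'
  rw [h1, h4, h2, ← Complex.coe_smul, map_smul, smul_smul, inv_mul_cancel₀ h5, one_smul,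
    Submodule.starProjection_eq_self_iff.2 (hc _)]

/-- Each `f ∈ K` is replaced by a simple function `G`. The joint level sets of these functions give
the partition and their values span `V`, so the operator fixes every `G`. Being a contraction, it
moves `f` by at most `2 * ‖f - G‖`. -/
theorem hasMetricApproximation_Lp [IsProbabilityMeasure μ] [CompleteSpace H] [Fact (1 ≤ p)]
    (hpt : p ≠ ⊤) : HasMetricApproximation (Lp H p μ) := by
  classical
  intro K ε hε
  have hex : ∀ f : K, ∃ g : SimpleFunc X H,
      eLpNorm (⇑(f : Lp H p μ) - ⇑g) p μ < ENNReal.ofReal (ε / 2) ∧ MemLp g p μ := fun f =>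
    (Lp.memLp f.1).exists_simpleFunc_eLpNorm_sub_lt hpt (by simpa using hε)
  choose g hg hgm using hex
  let J := ∀ f : K, {v // v ∈ (g f).range}
  let φ : X → J := fun x f => ⟨g f x, SimpleFunc.mem_range_self _ _⟩
  have hφ : ∀ j, MeasurableSet (φ ⁻¹' {j}) := fun j => by
    have : φ ⁻¹' {j} = ⋂ f : K, g f ⁻¹' {(j f).1} := by
      ext x
      rw [Set.mem_preimage, Set.mem_singleton_iff, Set.mem_iInter, funext_iff]
      exact forall_congr' fun f => Subtype.ext_iff
    rw [this]
    exact MeasurableSet.iInter fun f => (g f).measurableSet_fiber _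
  let V : Submodule ℂ H := Submodule.span ℂ (Finset.univ.biUnion fun f : K => (g f).range : Finset H)
  refine ⟨averageProj hφ V, averageProj_mem_finiteRank hφ V, norm_averageProj_le hpt hφ V,
    fun f hf => ?_⟩
  set G : Lp H p μ := (hgm ⟨f, hf⟩).toLp _
  have hG : averageProj hφ V G = G :=
    averageProj_of_ae_eq hφ V (c := fun j => (j ⟨f, hf⟩).1)
      (fun j => Submodule.subset_span (Finset.mem_coe.2 (Finset.mem_biUnion.2
        ⟨⟨f, hf⟩, Finset.mem_univ _, (j ⟨f, hf⟩).2⟩))) (MemLp.coeFn_toLp _)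
  have hfG : ‖f - G‖ ≤ ε / 2 := by
    have : f - G = ((Lp.memLp f).sub (hgm ⟨f, hf⟩)).toLp _ := by
      rw [MemLp.toLp_sub (Lp.memLp f), Lp.toLp_coeFn]
    rw [this, Lp.norm_toLp]
    exact ENNReal.toReal_le_of_le_ofReal (by positivity) (hg ⟨f, hf⟩).le
  have h1 : f - averageProj hφ V f = (f - G) - averageProj hφ V (f - G) := by
    rw [map_sub, hG]; abel
  rw [h1]
  have h2 := norm_sub_le (f - G) (averageProj hφ V (f - G))
  have h3 := norm_apply_le_of_norm_le_one (norm_averageProj_le hpt hφ V) (f - G)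
  linarith

end LpApproximation

/-! ### Singular values and sums over a Hilbert basis -/

section Schatten

variable {H : Type*} [NormedAddCommGroup H] [InnerProductSpace ℂ H]

theorem sum_mul_rpow_le_rpow_sum {κ : Type*} (t : Finset κ) {w x : κ → ℝ} (hw : ∀ j ∈ t, 0 ≤ w j)
    (hw1 : ∑ j ∈ t, w j ≤ 1) (hx : ∀ j ∈ t, 0 ≤ x j) {θ : ℝ} (hθ0 : 0 < θ) (hθ1 : θ ≤ 1) :
    ∑ j ∈ t, w j * x j ^ θ ≤ (∑ j ∈ t, w j * x j) ^ θ := by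
  -- Jensen needs total weight one: the missing mass is placed at the point `0`, where the power
  -- vanishes.
  have h := (Real.concaveOn_rpow hθ0.le hθ1).le_map_sum (t := t.insertNone)
    (w := fun j => j.elim (1 - ∑ j ∈ t, w j) w) (p := fun j => j.elim 0 x) ?_ ?_ ?_
  · simpa [Finset.sum_insertNone, Real.zero_rpow hθ0.ne'] using h
  · intro j hj
    cases j with
    | none => simpa using hw1
    | some j => exact hw j (by simpa using hj)
  · simp [Finset.sum_insertNone]
  · intro j hj
    cases j with
    | none => simp
    | some j => exact hx j (by simpa using hj)

theorem HilbertBasis.hasSum_norm_inner_sq {I : Type*} (e : HilbertBasis I ℂ H) (v : H) :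
    HasSum (fun α => ‖inner ℂ v (e α)‖ ^ 2) (‖v‖ ^ 2) := by
  have h := Complex.hasSum_re (e.hasSum_inner_mul_inner v v)
  rw [← inner_self_eq_norm_sq (𝕜 := ℂ)]
  refine h.congr_fun fun α => ?_
  rw [← inner_conj_symm (e α) v, RCLike.mul_conj]
  norm_cast

theorem hasSum_inner_smul_apply {I : Type*} (e : HilbertBasis I ℂ H) (T : H →L[ℂ] H) (v : H) :
    HasSum (fun α => innerSL ℂ (e α) v • T (e α)) (T v) := by
  simpa [e.repr_apply_apply] using (e.hasSum_repr v).mapL T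

variable [CompleteSpace H]

/-- The `s`-th powers of finitely many singular values are bounded by `∑ ‖T e‖ ^ s` for any Hilbert
basis `e`. -/
theorem sum_rpow_singularValues_le {I : Type*} (e : HilbertBasis I ℂ H) (T : H →L[ℂ] H) {s : ℝ}
    (hs0 : 0 < s) (hs1 : s ≤ 1) (hT : Summable fun α => ‖T (e α)‖ ^ s) {κ : Type*} [Fintype κ]
    {v : κ → H} (hv : Orthonormal ℂ v) {r : κ → ℝ} (hr : ∀ j, 0 < r j)
    (hTv : ∀ j, ContinuousLinearMap.adjoint T (T (v j)) = ((r j ^ 2 : ℝ) : ℂ) • v j) :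
    ∑ j, r j ^ s ≤ ∑' α, ‖T (e α)‖ ^ s := by
  classical
  -- The left singular vectors `r⁻¹ T v`, orthonormal because `T* T v = r² v`.
  have hu : Orthonormal ℂ fun j => ((r j)⁻¹ : ℂ) • T (v j) := by
    rw [orthonormal_iff_ite] at hv ⊢
    intro i j
    rw [inner_smul_left, inner_smul_right, ← ContinuousLinearMap.adjoint_inner_right, hTv,
      inner_smul_right, hv]
    split_ifs with hij
    · subst hij
      have : (r i : ℂ) ≠ 0 := by exact_mod_cast (hr i).ne'
      simp
      field_simp
    · simp
  -- The weights `|⟨v j, e α⟩|²` have sum at most one by Bessel. Jensen with exponent `s / 2` on the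
  -- `r j ^ 2`, then Bessel for the left singular vectors, gives the bound.
  have hα : ∀ α, ∑ j, ‖inner ℂ (v j) (e α)‖ ^ 2 * r j ^ s ≤ ‖T (e α)‖ ^ s := fun α => by
    have h1 := sum_mul_rpow_le_rpow_sum Finset.univ (w := fun j => ‖inner ℂ (v j) (e α)‖ ^ 2)
      (x := fun j => r j ^ 2) (fun j _ => by positivity)
      (by simpa [e.orthonormal.1 α] using hv.sum_inner_products_le (s := Finset.univ) (e α))
      (fun j _ => by positivity) (half_pos hs0) (by linarith)
    have h2 : ∀ a : ℝ, 0 ≤ a → (a ^ 2) ^ (s / 2) = a ^ s := fun a ha => by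
      rw [← Real.rpow_natCast, ← Real.rpow_mul ha]
      congr 1
      push_cast; ring
    simp only [fun j => h2 (r j) (hr j).le] at h1
    refine h1.trans ?_
    rw [← h2 _ (norm_nonneg _)]
    refine Real.rpow_le_rpow (Finset.sum_nonneg fun j _ => by positivity) ?_ (by positivity)
    refine le_trans (le_of_eq (Finset.sum_congr rfl fun j _ => ?_))
      (hu.sum_inner_products_le (s := Finset.univ) (T (e α)))
    have h3 : inner ℂ (((r j)⁻¹ : ℂ) • T (v j)) (T (e α)) = (r j : ℂ) * inner ℂ (v j) (e α) := by
      have : (r j : ℂ) ≠ 0 := by exact_mod_cast (hr j).ne'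
      rw [inner_smul_left, ← ContinuousLinearMap.adjoint_inner_left, hTv, inner_smul_left]
      simp
      field_simp
    rw [h3, norm_mul, Complex.norm_real, Real.norm_of_nonneg (hr j).le]
    ring
  -- Summing over `α` first, Parseval for each unit vector `v j` removes the weights.
  have hsum : HasSum (fun α => ∑ j, ‖inner ℂ (v j) (e α)‖ ^ 2 * r j ^ s) (∑ j, r j ^ s) := by
    refine hasSum_sum fun j _ => ?_
    simpa [hv.1 j] using (HilbertBasis.hasSum_norm_inner_sq e (v j)).mul_right (r j ^ s)
  exact hasSum_le hα hsum hT.hasSum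

theorem isSchatten_of_summable {I : Type*} (e : HilbertBasis I ℂ H) (T : H →L[ℂ] H) {s : ℝ}
    (hs0 : 0 < s) (hs1 : s ≤ 1) (hT : Summable fun α => ‖T (e α)‖ ^ s) : IsSchatten s T := by
  classical
  have hT1 : Summable fun α => ‖T (e α)‖ :=
    summable_of_summable_rpow hs0 hs1 (fun _ => norm_nonneg _) hT
  refine ⟨isCompactOperator_of_hasSum (g := fun α => innerSL ℂ (e α)) (h := fun α => T (e α))
    (by simpa [e.orthonormal.1] using hT1) (hasSum_inner_smul_apply e T), ?_⟩
  refine lt_of_le_of_lt ?_ (ENNReal.ofReal_lt_top (r := ∑' α, ‖T (e α)‖ ^ s))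
  rw [ENNReal.tsum_eq_iSup_sum]
  refine iSup_le fun K => ?_
  set S : H →L[ℂ] H := ContinuousLinearMap.adjoint T ∘L T
  let V : Set.Ioi (0 : ℝ) → Submodule ℂ H := fun r =>
    Module.End.eigenspace (S : Module.End ℂ H) (((r : ℝ) ^ 2 : ℝ) : ℂ)
  have hsymm : (S : H →ₗ[ℂ] H).IsSymmetric := fun x y => by
    simp [S, ContinuousLinearMap.adjoint_inner_left, ContinuousLinearMap.adjoint_inner_right]
  have hV : OrthogonalFamily ℂ (fun r : K => V r) fun r => (V r).subtypeₗᵢ :=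
    hsymm.orthogonalFamily_eigenspaces.comp (f := fun r : K => (((r : ℝ) ^ 2 : ℝ) : ℂ))
      fun a b hab => by
        have h1 : (a.1.1) ^ 2 = (b.1.1) ^ 2 := Complex.ofReal_injective hab
        have h2 := (pow_left_inj₀ (le_of_lt a.1.2) (le_of_lt b.1.2) two_ne_zero).1 h1
        exact Subtype.ext (Subtype.ext h2)
  -- The family is indexed by `finrank`, which is zero for an infinite dimensional eigenspace; the
  -- empty family then serves.
  have hb : ∀ r : K, ∃ b : Fin (Module.finrank ℂ (V r)) → V r, Orthonormal ℂ b := fun r => by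
    by_cases hfin : FiniteDimensional ℂ (V r)
    · exact ⟨stdOrthonormalBasis ℂ (V r), (stdOrthonormalBasis ℂ (V r)).orthonormal⟩
    · have h0 : IsEmpty (Fin (Module.finrank ℂ (V r))) := by
        rw [Module.finrank_of_not_finite hfin]; infer_instance
      exact ⟨isEmptyElim, ⟨isEmptyElim, fun i => isEmptyElim i⟩⟩
  choose b hb using hb
  have hon := hV.orthonormal_sigma_orthonormal hb
  have key := sum_rpow_singularValues_le e T hs0 hs1 hT hon (r := fun a => a.1.1.1)
    (fun a => a.1.1.2) fun a => Module.End.mem_eigenspace_iff.1 (b a.1 a.2).2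
  refine le_trans (le_of_eq ?_) (ENNReal.ofReal_le_ofReal key)
  rw [Fintype.sum_sigma, ENNReal.ofReal_sum_of_nonneg fun r _ => Finset.sum_nonneg fun _ _ =>
    Real.rpow_nonneg (le_of_lt r.1.2) s, ← Finset.sum_coe_sort]
  refine Finset.sum_congr rfl fun r _ => ?_
  rw [Finset.sum_congr rfl fun i _ => rfl, Finset.sum_const (r.1.1 ^ s), nsmul_eq_mul,
    ENNReal.ofReal_mul (Nat.cast_nonneg _), ENNReal.ofReal_natCast, Finset.card_fin]

end Schatten

/-! ### Series in `Lᵖ` and pointwise convergence -/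

section LpLemmas

variable {X : Type*} [MeasurableSpace X] {μ : Measure X} {ι : Type*} [Countable ι]
  {H : Type*} [NormedAddCommGroup H] {p : ℝ≥0∞}

/-- If a series converges in `Lᵖ` and almost everywhere, then the two sums agree. -/
theorem ae_eq_of_hasSum_Lp [Fact (1 ≤ p)] {F : ι → Lp H p μ} {L : Lp H p μ} (hL : HasSum F L)
    {f : ι → X → H} (hf : ∀ i, F i =ᵐ[μ] f i) {l : X → H}
    (hl : ∀ᵐ x ∂μ, HasSum (fun i => f i x) (l x)) : L =ᵐ[μ] l := by
  classical
  obtain ⟨K, hK, hae⟩ := (tendstoInMeasure_of_tendsto_Lp (f := fun K : Finset ι => ∑ i ∈ K, F i)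
    hL).exists_seq_tendsto_ae'
  have h1 : ∀ᵐ x ∂μ, ∀ i, F i x = f i x := ae_all_iff.2 hf
  have h2 : ∀ᵐ x ∂μ, ∀ k, (∑ i ∈ K k, F i : Lp H p μ) x = (∑ i ∈ K k, ⇑(F i)) x :=
    ae_all_iff.2 fun k => Lp.coeFn_finsetSum _ _
  filter_upwards [hae, h1, h2, hl] with x hx h1 h2 hl
  refine tendsto_nhds_unique hx ?_
  simp only [h2, Finset.sum_apply, h1]
  exact hl.comp hK

/-- On a probability space `L¹` norms are bounded by `Lᵖ` norms, so by Tonelli `∑ ‖f i x‖` has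
finite integral. -/
theorem ae_summable_norm_of_summable_eLpNorm [IsProbabilityMeasure μ] (hp : 1 ≤ p) {f : ι → X → H}
    (hf : ∀ i, MemLp (f i) p μ) (hs : Summable fun i => (eLpNorm (f i) p μ).toReal) :
    ∀ᵐ x ∂μ, Summable fun i => ‖f i x‖ := by
  have h1 : ∑' i, eLpNorm (f i) p μ ≠ ⊤ := by
    have := hs.tsum_ofReal_ne_top
    simpa [ENNReal.ofReal_toReal (hf _).eLpNorm_ne_top] using this
  have h2 : ∫⁻ x, ∑' i, ‖f i x‖ₑ ∂μ ≠ ⊤ := by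
    rw [lintegral_tsum fun i => (hf i).1.enorm]
    refine ne_top_of_le_ne_top h1 (ENNReal.tsum_le_tsum fun i => ?_)
    rw [← eLpNorm_one_eq_lintegral_enorm]
    exact eLpNorm_le_eLpNorm_of_exponent_le hp (hf i).1
  filter_upwards [ae_lt_top' (AEMeasurable.tsum fun i => (hf i).1.enorm) h2] with x hx
  simpa using ENNReal.summable_toReal hx.ne

end LpLemmas

/-! ### Monomials and Fourier coefficients on the torus -/

section Torus

open UnitAddTorus

variable {n : ℕ} {H : Type*} [NormedAddCommGroup H] [InnerProductSpace ℂ H]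

/-- The smooth function `x ↦ e^{2πi x·ξ} v`. -/
def monomial (ξ : Fin n → ℤ) (v : H) : SmoothFun n H :=
  ⟨fun x => mFourier ξ x • v, by
    change ContDiff ℝ ((⊤ : ℕ∞) : WithTop ℕ∞) fun y : Fin n → ℝ =>
      (∏ i, fourier (ξ i) (y i : UnitAddCircle) : ℂ) • v
    simp only [fourier_coe_apply]
    refine ContDiff.smul (contDiff_prod fun i _ => ?_) contDiff_const
    refine ContDiff.cexp ?_
    have : ContDiff ℝ ((⊤ : ℕ∞) : WithTop ℕ∞) fun y : Fin n → ℝ => ((y i : ℝ) : ℂ) :=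
      Complex.ofRealCLM.contDiff.comp (contDiff_apply ℝ ℝ i)
    exact (contDiff_const.mul this).div_const _⟩

theorem monomial_apply (ξ : Fin n → ℤ) (v : H) (x : UnitAddTorus (Fin n)) :
    (monomial ξ v : UnitAddTorus (Fin n) → H) x = mFourier ξ x • v := rfl

theorem norm_mFourier_apply (ξ : Fin n → ℤ) (x : UnitAddTorus (Fin n)) : ‖mFourier ξ x‖ = 1 := by
  simp only [mFourier, ContinuousMap.coe_mk, norm_prod, fourier_apply, Circle.norm_coe,
    Finset.prod_const_one]

theorem integral_mFourier_mul (ξ η : Fin n → ℤ) :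
    ∫ x, mFourier (-η) x * mFourier ξ x ∂(torusMeasure n) = if η = ξ then 1 else 0 := by
  have h := orthonormal_iff_ite.1 (orthonormal_mFourier (d := Fin n)) η ξ
  rw [ContinuousMap.inner_toLp] at h
  rw [← h]
  refine integral_congr_ae (Filter.Eventually.of_forall fun x => ?_)
  simp only [mFourier_neg]
  exact mul_comm _ _

theorem mFourierCoeff_monomial [CompleteSpace H] (ξ η : Fin n → ℤ) (v : H) :
    mFourierCoeff (monomial ξ v : UnitAddTorus (Fin n) → H) η = if η = ξ then v else 0 := by
  have h : mFourierCoeff (monomial ξ v : UnitAddTorus (Fin n) → H) η =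
      ∫ x, (mFourier (-η) x * mFourier ξ x) • v ∂(torusMeasure n) :=
    integral_congr_ae (Filter.Eventually.of_forall fun x => smul_smul _ _ _)
  rw [h, integral_smul_const, integral_mFourier_mul]
  split_ifs <;> simp

theorem IsPseudoDifferential.apply_monomial [CompleteSpace H]
    {A : SmoothFun n H →ₗ[ℂ] SmoothFun n H}
    {σ : UnitAddTorus (Fin n) → (Fin n → ℤ) → (H →L[ℂ] H)} (hA : IsPseudoDifferential A σ)
    (ξ : Fin n → ℤ) (v : H) (x : UnitAddTorus (Fin n)) :
    (A (monomial ξ v) : UnitAddTorus (Fin n) → H) x = mFourier ξ x • σ x ξ v := by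
  have h := hA (monomial ξ v) x
  simp only [mFourierCoeff_monomial] at h
  have h' := hasSum_single (f := fun η : Fin n → ℤ =>
    mFourier η x • σ x η (if η = ξ then v else 0)) ξ fun η hη => by simp [hη]
  simpa using h.unique h'

/-- The Fourier coefficient as an operator on `Lᵖ`. -/
def fourierCoeffCLM (p : ℝ≥0∞) [Fact (1 ≤ p)] (ξ : Fin n → ℤ) :
    Lp H p (torusMeasure n) →L[ℂ] H :=
  weightedIntegral (mFourier (-ξ)) (mFourier (-ξ)).continuous.aestronglyMeasurable
    fun x => (norm_mFourier_apply _ x).le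

theorem fourierCoeffCLM_toLp (p : ℝ≥0∞) [Fact (1 ≤ p)] (ξ : Fin n → ℤ) (f : SmoothFun n H) :
    fourierCoeffCLM p ξ (SmoothFun.toLp f p) = mFourierCoeff (f : UnitAddTorus (Fin n) → H) ξ := by
  rw [fourierCoeffCLM, weightedIntegral_apply]
  refine integral_congr_ae ?_
  filter_upwards [(SmoothFun.memLp f p).coeFn_toLp] with x hx
  rw [SmoothFun.toLp, hx]

theorem norm_fourierCoeffCLM_le (p : ℝ≥0∞) [Fact (1 ≤ p)] (ξ : Fin n → ℤ) :
    ‖(fourierCoeffCLM p ξ : Lp H p (torusMeasure n) →L[ℂ] H)‖ ≤ 1 :=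
  norm_weightedIntegral_le _ _

theorem dense_span_mFourier_toLp {p : ℝ≥0∞} [Fact (1 ≤ p)] (hp : p ≠ ⊤) :
    Dense (Submodule.span ℂ (Set.range fun ξ : Fin n → ℤ =>
      ContinuousMap.toLp (E := ℂ) p (torusMeasure n) ℂ (mFourier ξ)) :
      Set (Lp ℂ p (torusMeasure n))) := by
  rw [Submodule.dense_iff_topologicalClosure_eq_top]
  exact span_mFourierLp_closure_eq_top hp

/-- Bounded operators on `Lᵖ(𝕋ⁿ, H)` are determined by their values on monomials. -/
theorem clm_ext_monomial {p : ℝ≥0∞} [Fact (1 ≤ p)] (hp : p ≠ ⊤) {F : Type*} [NormedAddCommGroup F]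
    [NormedSpace ℂ F] {T T' : Lp H p (torusMeasure n) →L[ℂ] F}
    (h : ∀ ξ (v : H), T (SmoothFun.toLp (monomial ξ v) p) = T' (SmoothFun.toLp (monomial ξ v) p)) : T = T' := by
  ext f
  refine Lp.induction hp (fun f => T f = T' f) (fun c s hs hμs => ?_)
    (fun f g hf hg _ h1 h2 => by rw [map_add, map_add, h1, h2])
    (isClosed_eq T.continuous T'.continuous) f
  -- `R` is `g ↦ g • c`; it reduces the vector-valued claim to density of trigonometric polynomials
  -- in scalar `Lᵖ`.
  set R : Lp ℂ p (torusMeasure n) →L[ℂ] Lp H p (torusMeasure n) :=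
    (ContinuousLinearMap.toSpanSingleton ℂ c).compLpL p (torusMeasure n)
  have hR : T ∘L R = T' ∘L R := by
    refine ContinuousLinearMap.ext_on (dense_span_mFourier_toLp hp) ?_
    rintro _ ⟨ξ, rfl⟩
    have : R (ContinuousMap.toLp (E := ℂ) p (torusMeasure n) ℂ (mFourier ξ)) =
        SmoothFun.toLp (monomial ξ c) p := by
      ext1
      filter_upwards [ContinuousLinearMap.coeFn_compLpL (p := p)
        (ContinuousLinearMap.toSpanSingleton ℂ c)
        (ContinuousMap.toLp (E := ℂ) p (torusMeasure n) ℂ (mFourier ξ)),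
        ContinuousMap.coeFn_toLp (p := p) (𝕜 := ℂ) (torusMeasure n) (mFourier ξ),
        (SmoothFun.memLp (monomial ξ c) p).coeFn_toLp] with x h1 h2 h3
      rw [h1, h2, SmoothFun.toLp, h3]
      simp [monomial_apply]
    simpa [this] using h ξ c
  have : (Lp.simpleFunc.indicatorConst p hs hμs.ne c : Lp H p (torusMeasure n)) =
      R (indicatorConstLp p hs hμs.ne 1) := by
    rw [Lp.simpleFunc.coe_indicatorConst]
    ext1
    filter_upwards [ContinuousLinearMap.coeFn_compLpL (p := p)
      (ContinuousLinearMap.toSpanSingleton ℂ c) (indicatorConstLp p hs hμs.ne 1),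
      indicatorConstLp_coeFn (p := p) (hs := hs) (hμs := hμs.ne) (c := (1 : ℂ)),
      indicatorConstLp_coeFn (p := p) (hs := hs) (hμs := hμs.ne) (c := c)] with x h1 h2 h3
    rw [h1, h2, h3]
    by_cases hx : x ∈ s <;> simp [hx]
  rw [this]
  exact DFunLike.congr_fun hR _

end Torus

open UnitAddTorus

theorem exists_clm_hasSum {ι E F : Type*} [NormedAddCommGroup E] [NormedSpace ℂ E]
    [NormedAddCommGroup F] [NormedSpace ℂ F] [CompleteSpace F] {g : ι → E →L[ℂ] ℂ} {h : ι → F}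
    (hgh : Summable fun k => ‖g k‖ * ‖h k‖) :
    ∃ T : E →L[ℂ] F, ∀ f, HasSum (fun k => g k f • h k) (T f) := by
  have hs : Summable fun k => (g k).smulRight (h k) := Summable.of_norm (by simpa using hgh)
  exact ⟨_, fun f => by simpa using hs.hasSum.mapL (ContinuousLinearMap.apply ℂ F f)⟩

/-- Distinct basis vectors are at distance `√2`, so balls of radius `1 / 2` around them are
disjoint. -/
theorem countable_of_hilbertBasis {H : Type*} [NormedAddCommGroup H] [InnerProductSpace ℂ H]
    [TopologicalSpace.SeparableSpace H] {I : Type*} (e : HilbertBasis I ℂ H) : Countable I := by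
  refine Pairwise.countable_of_isOpen_disjoint (s := fun α => Metric.ball (e α) (1 / 2))
    (fun α β hαβ => Metric.ball_disjoint_ball ?_) (fun α => Metric.isOpen_ball)
    fun α => ⟨e α, Metric.mem_ball_self (by norm_num)⟩
  have h : ‖e α - e β‖ ^ 2 = 2 := by
    rw [@norm_sub_sq ℂ, e.orthonormal.1, e.orthonormal.1, e.orthonormal.2 hαβ]
    norm_num
  rw [dist_eq_norm]
  nlinarith [norm_nonneg (e α - e β)]

/-! ### The rank one series attached to the symbol -/

section Symbol

variable {n : ℕ} {H : Type*} [NormedAddCommGroup H] [InnerProductSpace ℂ H] {I : Type*}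

/-- The functional `f ↦ ⟨e_α, f̂(ξ)⟩` on `Lᵖ`. -/
def coeffFunctional (e : HilbertBasis I ℂ H) (p : ℝ≥0∞) [Fact (1 ≤ p)] (q : (Fin n → ℤ) × I) :
    Lp H p (torusMeasure n) →L[ℂ] ℂ :=
  innerSL ℂ (e q.2) ∘L fourierCoeffCLM p q.1

/-- The function `x ↦ e^{2πi x·ξ} σ(x, ξ) e_α` in `Lᵖ`. -/
def symbolLp (e : HilbertBasis I ℂ H) (A : SmoothFun n H →ₗ[ℂ] SmoothFun n H) (p : ℝ≥0∞)
    (q : (Fin n → ℤ) × I) : Lp H p (torusMeasure n) :=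
  SmoothFun.toLp (A (monomial q.1 (e q.2))) p

theorem norm_coeffFunctional_le (e : HilbertBasis I ℂ H) (p : ℝ≥0∞) [Fact (1 ≤ p)]
    (q : (Fin n → ℤ) × I) : ‖coeffFunctional e p q‖ ≤ 1 := by
  refine (ContinuousLinearMap.opNorm_comp_le _ _).trans ?_
  rw [innerSL_apply_norm, e.orthonormal.1, one_mul]
  exact norm_fourierCoeffCLM_le p q.1

variable [CompleteSpace H] {e : HilbertBasis I ℂ H} {A : SmoothFun n H →ₗ[ℂ] SmoothFun n H}
  {σ : UnitAddTorus (Fin n) → (Fin n → ℤ) → (H →L[ℂ] H)} {p : ℝ≥0∞}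

theorem norm_symbolLp (hA : IsPseudoDifferential A σ) (q : (Fin n → ℤ) × I) :
    ‖symbolLp e A p q‖ = (eLpNorm (fun x => σ x q.1 (e q.2)) p (torusMeasure n)).toReal := by
  rw [symbolLp, SmoothFun.toLp, Lp.norm_toLp]
  congr 1
  refine eLpNorm_congr_norm_ae (Filter.Eventually.of_forall fun x => ?_)
  rw [hA.apply_monomial, norm_smul, norm_mFourier_apply, one_mul]

theorem summable_norm_symbolLp_rpow (hA : IsPseudoDifferential A σ) {s : ℝ}
    (hσ : ∑' ξ : Fin n → ℤ, ∑' α : I,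
      eLpNorm (fun x => σ x ξ (e α)) p (torusMeasure n) ^ s < ⊤) :
    Summable fun q => ‖symbolLp e A p q‖ ^ s := by
  rw [← ENNReal.tsum_prod] at hσ
  have := ENNReal.summable_toReal hσ.ne
  simpa only [norm_symbolLp hA, ENNReal.toReal_rpow] using this

theorem coeffFunctional_symbolLp [Fact (1 ≤ p)] (hA : IsPseudoDifferential A σ)
    (q : (Fin n → ℤ) × I) : coeffFunctional e p q (symbolLp e A p q) =
      ∫ x, inner ℂ (e q.2) (σ x q.1 (e q.2)) ∂(torusMeasure n) := by
  have h1 : fourierCoeffCLM p q.1 (symbolLp e A p q) =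
      ∫ x, σ x q.1 (e q.2) ∂(torusMeasure n) := by
    rw [symbolLp, fourierCoeffCLM_toLp]
    refine integral_congr_ae (Filter.Eventually.of_forall fun x => ?_)
    simp only [hA.apply_monomial, smul_smul]
    rw [mFourier_neg, RCLike.conj_mul, norm_mFourier_apply]
    simp
  -- No regularity of `σ` is assumed: integrability comes from the smooth image of a monomial,
  -- multiplied by the inverse character.
  have h2 : Integrable (fun x => σ x q.1 (e q.2)) (torusMeasure n) := by
    have h3 := (SmoothFun.memLp (A (monomial q.1 (e q.2))) 1).integrable le_rfl
    refine (integrable_smul_of_memLp le_rfl (w := mFourier (-q.1))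
      (mFourier (-q.1)).continuous.aestronglyMeasurable (fun x => (norm_mFourier_apply _ x).le)
      (memLp_one_iff_integrable.2 h3)).congr (Filter.Eventually.of_forall fun x => ?_)
    simp only [hA.apply_monomial, smul_smul]
    rw [mFourier_neg, RCLike.conj_mul, norm_mFourier_apply]
    simp
  rw [coeffFunctional, ContinuousLinearMap.comp_apply, h1, innerSL_apply_apply, integral_inner h2]

/-- The series of rank one operators given by the symbol represents `A` on smooth functions. -/
theorem eq_toLp_of_hasSum [Countable I] [Fact (1 ≤ p)] {p₁ : ℝ≥0∞} [Fact (1 ≤ p₁)]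
    (hA : IsPseudoDifferential A σ) (hs : Summable fun q => ‖symbolLp e A p q‖)
    (f : SmoothFun n H) {L : Lp H p (torusMeasure n)}
    (hL : HasSum (fun q => coeffFunctional e p₁ q (SmoothFun.toLp f p₁) • symbolLp e A p q) L) :
    L = SmoothFun.toLp (A f) p := by
  have hc : ∀ q, coeffFunctional e p₁ q (SmoothFun.toLp f p₁) =
      inner ℂ (e q.2) (mFourierCoeff (f : UnitAddTorus (Fin n) → H) q.1) := fun q => by
    rw [coeffFunctional, ContinuousLinearMap.comp_apply, fourierCoeffCLM_toLp, innerSL_apply_apply]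
  have hbd : ∀ q, ‖coeffFunctional e p₁ q (SmoothFun.toLp f p₁)‖ ≤ ‖SmoothFun.toLp f p₁‖ :=
    fun q => norm_apply_le_of_norm_le_one (norm_coeffFunctional_le e p₁ q) _
  have hmem : ∀ q : (Fin n → ℤ) × I,
      MemLp (A (monomial q.1 (e q.2)) : UnitAddTorus (Fin n) → H) p (torusMeasure n) :=
    fun q => SmoothFun.memLp _ p
  have hs' : Summable fun q : (Fin n → ℤ) × I => (eLpNorm
      (A (monomial q.1 (e q.2)) : UnitAddTorus (Fin n) → H) p (torusMeasure n)).toReal := by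
    simpa only [symbolLp, SmoothFun.toLp, Lp.norm_toLp] using hs
  have hae := ae_summable_norm_of_summable_eLpNorm Fact.out hmem hs'
  have hL' : L =ᵐ[torusMeasure n] (A f : UnitAddTorus (Fin n) → H) := by
    refine ae_eq_of_hasSum_Lp hL (f := fun q x => coeffFunctional e p₁ q (SmoothFun.toLp f p₁) •
      (A (monomial q.1 (e q.2)) : UnitAddTorus (Fin n) → H) x) (fun q => ?_) ?_
    · filter_upwards [Lp.coeFn_smul (coeffFunctional e p₁ q (SmoothFun.toLp f p₁))
        (symbolLp e A p q), (hmem q).coeFn_toLp] with x h1 h2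
      rw [h1, Pi.smul_apply]
      congr 1
    · filter_upwards [hae] with x hx
      have hsum : Summable fun q => coeffFunctional e p₁ q (SmoothFun.toLp f p₁) •
          (A (monomial q.1 (e q.2)) : UnitAddTorus (Fin n) → H) x := by
        refine Summable.of_norm_bounded (hx.mul_left ‖SmoothFun.toLp f p₁‖) fun q => ?_
        rw [norm_smul]
        exact mul_le_mul_of_nonneg_right (hbd q) (norm_nonneg _)
      -- Absolute convergence at `x` allows grouping by `ξ`; each inner sum is `σ x ξ` applied to
      -- the basis expansion of the Fourier coefficient, which recovers the series defining `A f x`.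
      have h1 := hsum.hasSum.prod_fiberwise (g := fun ξ => mFourier ξ x •
        σ x ξ (mFourierCoeff (f : UnitAddTorus (Fin n) → H) ξ)) fun ξ => by
          have := (hasSum_inner_smul_apply e (σ x ξ)
            (mFourierCoeff (f : UnitAddTorus (Fin n) → H) ξ)).const_smul (mFourier ξ x)
          refine this.congr_fun fun α => ?_
          rw [hc, hA.apply_monomial, innerSL_apply_apply, smul_comm]
      rw [(hA f x).unique h1]
      exact hsum.hasSum
  ext1
  exact hL'.trans (SmoothFun.memLp (A f) p).coeFn_toLp.symm

/-- This carries estimates on `σ` over to `τ` without identifying the two symbols. -/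
theorem IsFourierMultiplier.fourierCoeffCLM_symbolLp [Fact (1 ≤ p)]
    {τ : (Fin n → ℤ) → (H →L[ℂ] H)} (hτ : IsFourierMultiplier A τ) (q : (Fin n → ℤ) × I) :
    fourierCoeffCLM p q.1 (symbolLp e A p q) = τ q.1 (e q.2) := by
  rw [symbolLp, fourierCoeffCLM_toLp, hτ, mFourierCoeff_monomial, if_pos rfl]

end Symbol

end PeriodicPDO

end

/-! ### Assembly of the three assertions -/

theorem theorem3p7 {n : ℕ} {H : Type*} [NormedAddCommGroup H] [InnerProductSpace ℂ H]
    [CompleteSpace H] [TopologicalSpace.SeparableSpace H] {I : Type*} (e : HilbertBasis I ℂ H)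
    (s : ℝ) (hs0 : 0 < s) (hs1 : s ≤ 1)
    (A : PeriodicPDO.SmoothFun n H →ₗ[ℂ] PeriodicPDO.SmoothFun n H)
    (σ : UnitAddTorus (Fin n) → (Fin n → ℤ) → (H →L[ℂ] H))
    (hA : PeriodicPDO.IsPseudoDifferential A σ)
    (p₁ p₂ : ℝ≥0∞) [Fact (1 ≤ p₁)] [Fact (1 ≤ p₂)] (hp₁ : p₁ ≠ ⊤) (hp₂ : p₂ ≠ ⊤)
    (hσ : ∑' ξ : Fin n → ℤ, ∑' α : I,
      eLpNorm (fun x => σ x ξ (e α)) p₂ (PeriodicPDO.torusMeasure n) ^ s < ⊤) :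
    -- `A` extends to an `s`-nuclear operator `L^{p₁} → L^{p₂}`
    (∃ T : Lp H p₁ (PeriodicPDO.torusMeasure n) →L[ℂ] Lp H p₂ (PeriodicPDO.torusMeasure n),
      PeriodicPDO.Extends T A ∧ PeriodicPDO.IsSNuclear s T) ∧
    -- trace formula for the extension of `A` to `L^p`, `p = p₂`
    (Summable (fun q : (Fin n → ℤ) × I =>
        ∫ x, inner ℂ (e q.2) (σ x q.1 (e q.2)) ∂(PeriodicPDO.torusMeasure n)) ∧
      ∀ T : Lp H p₂ (PeriodicPDO.torusMeasure n) →L[ℂ] Lp H p₂ (PeriodicPDO.torusMeasure n),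
        PeriodicPDO.Extends T A →
          PeriodicPDO.IsSNuclear s T ∧
          PeriodicPDO.HasNuclearTrace T (∑' ξ : Fin n → ℤ, ∑' α : I,
            ∫ x, inner ℂ (e α) (σ x ξ (e α)) ∂(PeriodicPDO.torusMeasure n))) ∧
    -- Fourier multipliers
    (∀ τ : (Fin n → ℤ) → (H →L[ℂ] H), PeriodicPDO.IsFourierMultiplier A τ →
      (∀ ξ, PeriodicPDO.IsSchatten s (τ ξ)) ∧
      ∃ t : (Fin n → ℤ) → ℂ,
        (∀ ξ, PeriodicPDO.HasNuclearTrace (τ ξ) (t ξ)) ∧ Summable t ∧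
        ∀ T : Lp H p₂ (PeriodicPDO.torusMeasure n) →L[ℂ] Lp H p₂ (PeriodicPDO.torusMeasure n),
          PeriodicPDO.Extends T A → PeriodicPDO.HasNuclearTrace T (∑' ξ, t ξ)) := by
  classical
  have : Countable I := PeriodicPDO.countable_of_hilbertBasis e
  have hss := PeriodicPDO.summable_norm_symbolLp_rpow hA hσ
  have hs := PeriodicPDO.summable_of_summable_rpow hs0 hs1 (fun _ => norm_nonneg _) hss
  have hgs : ∀ (p : ℝ≥0∞) [Fact (1 ≤ p)], Summable fun q : (Fin n → ℤ) × I =>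
      ‖PeriodicPDO.coeffFunctional e p q‖ ^ s * ‖PeriodicPDO.symbolLp e A p₂ q‖ ^ s := fun p _ =>
    Summable.of_nonneg_of_le (fun q => by positivity) (fun q =>
      mul_le_of_le_one_left (by positivity) (Real.rpow_le_one (norm_nonneg (PeriodicPDO.coeffFunctional e p q))
        (PeriodicPDO.norm_coeffFunctional_le e p q) hs0.le)) hss
  have hg1 : ∀ (p : ℝ≥0∞) [Fact (1 ≤ p)], Summable fun q : (Fin n → ℤ) × I =>
      ‖PeriodicPDO.coeffFunctional e p q‖ * ‖PeriodicPDO.symbolLp e A p₂ q‖ := fun p _ =>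
    Summable.of_nonneg_of_le (fun q => by positivity) (fun q =>
      mul_le_of_le_one_left (norm_nonneg _) (PeriodicPDO.norm_coeffFunctional_le e p q)) hs
  have hbound : ∀ q : (Fin n → ℤ) × I, ‖PeriodicPDO.coeffFunctional e p₂ q
      (PeriodicPDO.symbolLp e A p₂ q)‖ ≤ ‖PeriodicPDO.symbolLp e A p₂ q‖ := fun q =>
    PeriodicPDO.norm_apply_le_of_norm_le_one (PeriodicPDO.norm_coeffFunctional_le e p₂ q) _
  have hsum : Summable fun q : (Fin n → ℤ) × I =>
      PeriodicPDO.coeffFunctional e p₂ q (PeriodicPDO.symbolLp e A p₂ q) :=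
    Summable.of_norm_bounded hs hbound
  have htr : ∀ q : (Fin n → ℤ) × I, PeriodicPDO.coeffFunctional e p₂ q
      (PeriodicPDO.symbolLp e A p₂ q) =
        ∫ x, inner ℂ (e q.2) (σ x q.1 (e q.2)) ∂(PeriodicPDO.torusMeasure n) :=
    PeriodicPDO.coeffFunctional_symbolLp hA
  have hsum' := hsum
  simp only [htr] at hsum'
  have hrep : ∀ T : Lp H p₂ (PeriodicPDO.torusMeasure n) →L[ℂ]
      Lp H p₂ (PeriodicPDO.torusMeasure n), PeriodicPDO.Extends T A → ∀ f, HasSum (fun q =>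
        PeriodicPDO.coeffFunctional e p₂ q f • PeriodicPDO.symbolLp e A p₂ q) (T f) := by
    intro T hT
    obtain ⟨T', hT'⟩ := PeriodicPDO.exists_clm_hasSum (hg1 p₂)
    -- Both operators extend `A`, so they agree on monomials and the series represents every bounded
    -- extension.
    have : T = T' := PeriodicPDO.clm_ext_monomial hp₂ fun ξ v => by
      rw [hT, PeriodicPDO.eq_toLp_of_hasSum hA hs _ (hT' _)]
    rwa [this]
  have htrace : ∀ T : Lp H p₂ (PeriodicPDO.torusMeasure n) →L[ℂ]
      Lp H p₂ (PeriodicPDO.torusMeasure n), PeriodicPDO.Extends T A →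
        PeriodicPDO.HasNuclearTrace T (∑' ξ : Fin n → ℤ, ∑' α : I,
          ∫ x, inner ℂ (e α) (σ x ξ (e α)) ∂(PeriodicPDO.torusMeasure n)) := by
    intro T hT
    refine (PeriodicPDO.hasMetricApproximation_Lp hp₂).hasNuclearTrace (hg1 p₂) (hrep T hT) ?_
    have h := hsum'.hasSum
    rw [hsum'.tsum_prod] at h
    simpa only [htr] using h
  refine ⟨?_, ⟨hsum', fun T hT => ⟨PeriodicPDO.IsSNuclear.of_countable hs0 (hgs p₂) (hrep T hT),
    htrace T hT⟩⟩, fun τ hτ => ?_⟩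
  · obtain ⟨T, hT⟩ := PeriodicPDO.exists_clm_hasSum (hg1 p₁)
    exact ⟨T, fun f => PeriodicPDO.eq_toLp_of_hasSum hA hs f (hT _),
      PeriodicPDO.IsSNuclear.of_countable hs0 (hgs p₁) hT⟩
  · have hle : ∀ ξ α, ‖τ ξ (e α)‖ ≤ ‖PeriodicPDO.symbolLp e A p₂ (ξ, α)‖ := fun ξ α => by
      rw [← hτ.fourierCoeffCLM_symbolLp (p := p₂) (e := e) (ξ, α)]
      exact PeriodicPDO.norm_apply_le_of_norm_le_one (PeriodicPDO.norm_fourierCoeffCLM_le p₂ ξ) _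
    have hτs : ∀ ξ, Summable fun α => ‖τ ξ (e α)‖ ^ s := fun ξ =>
      Summable.of_nonneg_of_le (fun α => by positivity)
        (fun α => Real.rpow_le_rpow (norm_nonneg _) (hle ξ α) hs0.le) (hss.prod_factor ξ)
    have hτ1 : ∀ ξ, Summable fun α => ‖τ ξ (e α)‖ := fun ξ =>
      PeriodicPDO.summable_of_summable_rpow hs0 hs1 (fun _ => norm_nonneg _) (hτs ξ)
    refine ⟨fun ξ => PeriodicPDO.isSchatten_of_summable e (τ ξ) hs0 hs1 (hτs ξ),
      -- Taking the trace of `τ ξ` in this form makes the sum over `ξ` literally the trace formula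
      -- already proved; the Fourier coefficient identity matches its terms with `⟨τ ξ (e α), e α⟩`.
      fun ξ => ∑' α : I, ∫ x, inner ℂ (e α) (σ x ξ (e α)) ∂(PeriodicPDO.torusMeasure n),
      fun ξ => ?_, hsum'.prod, htrace⟩
    refine PeriodicPDO.hasMetricApproximation_hilbert.hasNuclearTrace
      (g := fun α => innerSL ℂ (e α)) (h := fun α => τ ξ (e α))
      (by simpa [e.orthonormal.1] using hτ1 ξ) (PeriodicPDO.hasSum_inner_smul_apply e (τ ξ)) ?_
    refine (hsum'.prod_factor ξ).hasSum.congr_fun fun α => ?_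
    rw [← htr (ξ, α), PeriodicPDO.coeffFunctional, ContinuousLinearMap.comp_apply,
      hτ.fourierCoeffCLM_symbolLp]
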